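/- All spaces are Hausdorff. For an ordinal $\alpha$, let $2^{\alpha}_{\mathrm{lex}}$ be the set of all functions $\alpha\to 2=\{0,1\}$ with the lexicographic order and its order topology. Points $a,b$ of a compact space $X$ are \emph{pin equivalent} if there are a compact space $Y$, a continuous surjection $f\colon Y\to X$ and a homeomorphism $g\colon Y\to Y$ with $g(f^{-1}\{a\})=f^{-1}\{b\}$; a compact space is \emph{pin homogeneous} if every two of its points are pin equivalent. A set $\mathcal S$ of subsets of $X$ is a \emph{neighborhood subbase} at $a\in X$ if the neighborhood filter of $a$ is the smallest filter containing $\mathcal S$. Subalgebras $A_0,\dots,A_n$ of a Boolean algebra are \emph{independent} if $x_0\wedge\dots\wedge x_n\neq 0$ whenever $0\neq x_m\in A_m$ for all $m\le n$. Theorem. For each $n<\omega$, the product space $X=\prod_{m\le n}2^{\omega_m}_{\mathrm{lex}}$ is compact and pin homogeneous. Moreover, every point $y\in X$ has a neighborhood subbase of the form $\bigcup_{m\le n}\{R^m_\alpha : \alpha<\omega_m\}$, where for each $m\le n$ the sequence $(R^m_\alpha)_{\alpha<\omega_m}$ of subsets of $X$ is strictly decreasing ($R^m_\alpha\supsetneq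 R^m_\beta$ for $\alpha<\beta<\omega_m$), and the subalgebras $\mathcal A_0,\dots,\mathcal A_n$ of the power set Boolean algebra $\mathcal P(X)$, with $\mathcal A_m$ generated by $\{R^m_\alpha:\alpha<\omega_m\}$, are independent. -/

import Mathlib

open scoped Ordinal Topology

universe u

/-- Subsets `A`, `B` of a compact Hausdorff space `X` are pin equivalent if, for some compact
Hausdorff `Y`, continuous surjection `f : Y → X` and homeomorphism `g : Y → Y`, the image under
`g` of the preimage of `A` is the preimage of `B`.  (Meant for closed `A`, `B`.) -/
def SetsPinEquivalent {X : Type u} [TopologicalSpace X] (A B : Set X) : Prop :=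
  ∃ (Y : Type u) (_ : TopologicalSpace Y) (_ : CompactSpace Y) (_ : T2Space Y)
    (f : Y → X) (g : Y ≃ₜ Y),
    Continuous f ∧ Function.Surjective f ∧ g '' (f ⁻¹' A) = f ⁻¹' B

/-- Pin equivalence of points. -/
def PinEquivalent {X : Type u} [TopologicalSpace X] (a b : X) : Prop :=
  SetsPinEquivalent {a} {b}

/-- A pin homogeneous space: a compact Hausdorff space all of whose pairs of points are pin
equivalent. -/
structure PinHomogeneous (X : Type u) [TopologicalSpace X] : Prop where
  compact : CompactSpace X
  hausdorff : T2Space X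
  pinEquivalent : ∀ a b : X, PinEquivalent a b

/-- The set of all functions from the ordinal `α` to `2`; a fresh type, so that it carries only the
order and the topology given below. -/
def TwoLex (α : Ordinal.{u}) : Type u := Lex (α.ToType → Fin 2)

/-- The lexicographic order: `f < g` iff `f i < g i` at the least `i` where they differ. -/
noncomputable instance (α : Ordinal.{u}) : LinearOrder (TwoLex α) :=
  inferInstanceAs (LinearOrder (Lex (α.ToType → Fin 2)))

/-- The order topology. -/
noncomputable instance (α : Ordinal.{u}) : TopologicalSpace (TwoLex α) := Preorder.topology (TwoLex α)

instance (α : Ordinal.{u}) : OrderTopology (TwoLex α) := ⟨rfl⟩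

/-- The product of the spaces `2^{ω_m}_lex`, `m ≤ n`, with the product topology. -/
abbrev TwoLexProd (n : ℕ) : Type := ∀ m : Fin (n + 1), TwoLex (ω_ ((m : ℕ) : Ordinal.{0}))

/-- `S` is a neighborhood subbase at `a`: the neighborhood filter of `a` is the smallest filter
containing `S`. -/
def IsNeighborhoodSubbase {X : Type u} [TopologicalSpace X] (a : X) (S : Set (Set X)) : Prop :=
  Filter.generate S = 𝓝 a

/-- Finitely many subalgebras of a Boolean algebra are independent if every choice of one nonzero
element from each has nonzero meet. -/
def IndependentSubalgebras {ι : Type*} [Fintype ι] {B : Type*} [BooleanAlgebra B]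
    (A : ι → BooleanSubalgebra B) : Prop :=
  ∀ x : ι → B, (∀ i, x i ∈ A i) → (∀ i, x i ≠ ⊥) → Finset.univ.inf x ≠ ⊥

/-! At a point `y` of one factor, the clopen sets `nearSet y (y i) i` form a neighborhood subbase.
Some digit `b` occurs cofinally in `y`; since `ω_m` is regular, its places form a sequence of type
`ω_m`. The places of the other digit are empty, have a maximum, or have cofinality `ω_k` for some `k
≤ m`. In the product, their sets are intersected into the sequence of length `ω_k`, so one
decreasing sequence per length suffices. Flipping `y` at a single place of digit `b` leaves the sets
of the other digit undisturbed, so every tuple of initial segments is the trace of a point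
(`TwoLexProd.exists_clopen_subbase`).

The possible traces thus do not depend on the point, and a shift on two-sided sequences gives pin
equivalence (`pinEquivalent_of_clopen_families`). That traces combine freely also gives strictness
and independence. -/

/-! ### Pin equivalence and independence from traces -/

/-- If two families of clopen sets realize the same traces, and `a`, `b` are the unique points
lying in all members of the respective families, then `a` and `b` are pin equivalent. -/
theorem pinEquivalent_of_clopen_families {X : Type u} [TopologicalSpace X] [CompactSpace X]
    [T2Space X] {J : Type*} {P Q : J → Set X} {a b : X}
    (hP : ∀ j, IsClopen (P j)) (hQ : ∀ j, IsClopen (Q j))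
    (hPQ : ∀ x, ∃ x', ∀ j, x ∈ P j ↔ x' ∈ Q j) (hQP : ∀ x, ∃ x', ∀ j, x ∈ Q j ↔ x' ∈ P j)
    (ha : ∀ x, (∀ j, x ∈ P j) ↔ x = a) (hb : ∀ x, (∀ j, x ∈ Q j) ↔ x = b) :
    PinEquivalent a b := by
  -- The `P`-trace of each entry is the `Q`-trace of the next, so the shift carries `s 0 = a` to `s
  -- 0 = b`.
  let K : Set (ℤ → X) := {s | ∀ i j, s i ∈ P j ↔ s (i + 1) ∈ Q j}
  have hK : IsClosed K := by
    have : K = ⋂ (i : ℤ) (j : J),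
        ({s | s i ∈ P j} ⇨ {s | s (i + 1) ∈ Q j}) ∩ ({s | s (i + 1) ∈ Q j} ⇨ {s | s i ∈ P j}) := by
      ext s
      simp only [K, Set.mem_ofPred_eq, Set.mem_iInter]
      refine forall₂_congr fun i j => ?_
      simp only [himp_eq, Set.mem_inter_iff, Set.sup_eq_union, Set.mem_union, Set.mem_compl_iff,
        Set.mem_ofPred_eq]
      tauto
    rw [this]
    refine isClosed_iInter fun i => isClosed_iInter fun j => ?_
    have h1 : IsClopen {s : ℤ → X | s i ∈ P j} := (hP j).preimage (continuous_apply i)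
    have h2 : IsClopen {s : ℤ → X | s (i + 1) ∈ Q j} := (hQ j).preimage (continuous_apply (i + 1))
    exact ((h1.himp h2).inter (h2.himp h1)).isClosed
  have hKc : CompactSpace K := isCompact_iff_compactSpace.1 hK.isCompact
  let g : K ≃ₜ K :=
    { toFun := fun s => ⟨fun i => s.1 (i + 1), fun i j => s.2 (i + 1) j⟩
      invFun := fun s => ⟨fun i => s.1 (i - 1), fun i j => by
        simpa using s.2 (i - 1) j⟩
      left_inv := fun s => by ext i; simp
      right_inv := fun s => by ext i; simp
      continuous_toFun := by
        refine Continuous.subtype_mk (continuous_pi fun i => ?_) _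
        exact (continuous_apply (i + 1)).comp continuous_subtype_val
      continuous_invFun := by
        refine Continuous.subtype_mk (continuous_pi fun i => ?_) _
        exact (continuous_apply (i - 1)).comp continuous_subtype_val }
  refine ⟨K, instTopologicalSpaceSubtype, hKc, inferInstance, fun s => s.1 0, g,
    (continuous_apply (0 : ℤ)).comp continuous_subtype_val, fun x => ?_, ?_⟩
  · choose F hF using hPQ
    choose G hG using hQP
    -- `Int.negSucc n` is `-(n + 1)`, hence the exponent of `G`.
    let s : ℤ → X := fun i => Int.rec (fun n => F^[n] x) (fun n => G^[n + 1] x) i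
    refine ⟨⟨s, fun i j => ?_⟩, rfl⟩
    rcases i with n | n
    · change F^[n] x ∈ P j ↔ F^[n + 1] x ∈ Q j
      rw [Function.iterate_succ_apply']
      exact hF _ j
    · rcases n with _ | n
      · exact (hG x j).symm
      · change G^[n + 1 + 1] x ∈ P j ↔ G^[n + 1] x ∈ Q j
        rw [Function.iterate_succ_apply' G (n + 1)]
        exact (hG _ j).symm
  · have key : ∀ s : K, s.1 0 = a ↔ s.1 1 = b := fun s => by
      rw [← ha, ← hb]
      exact forall_congr' (s.2 0)
    ext s
    constructor
    · rintro ⟨t, ht, rfl⟩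
      exact (key t).1 ht
    · intro hs
      refine ⟨g.symm s, (key _).2 ?_, g.apply_symm_apply s⟩
      change s.1 (1 - 1) = b
      simpa using hs

/-- Membership of points in the subalgebra generated by a family is decided by the members of
the family containing them. -/
theorem mem_iff_mem_of_mem_closure_range {X ι : Type*} {R : ι → Set X} {x x' : X}
    (h : ∀ i, x ∈ R i ↔ x' ∈ R i) {Z : Set X}
    (hZ : Z ∈ BooleanSubalgebra.closure (Set.range R)) : x ∈ Z ↔ x' ∈ Z := by
  induction hZ using BooleanSubalgebra.closure_bot_sup_induction with
  | mem _ hx => obtain ⟨i, rfl⟩ := hx; exact h i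
  | bot => exact Iff.rfl
  | sup _ _ _ _ h1 h2 => exact or_congr h1 h2
  | compl _ _ h1 => exact not_congr h1

/-- Families of sets such that all choices of traces of points are simultaneously realized
generate independent subalgebras. -/
theorem independentSubalgebras_of_traces {X ι : Type*} [Fintype ι] {J : ι → Type*}
    {R : ∀ i, J i → Set X}
    (h : ∀ z : ι → X, ∃ x, ∀ i j, x ∈ R i j ↔ z i ∈ R i j) :
    IndependentSubalgebras fun i => BooleanSubalgebra.closure (Set.range (R i)) := by
  intro Z hZ hne hbot
  choose z hz using fun i => Set.nonempty_iff_ne_empty.2 (hne i)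
  obtain ⟨x, hx⟩ := h z
  have : {x} ≤ Finset.univ.inf Z := Finset.le_inf fun i _ => Set.singleton_subset_iff.2
    ((mem_iff_mem_of_mem_closure_range (hx i) (hZ i)).2 (hz i))
  rw [hbot] at this
  exact this rfl

/-! ### Clopen neighborhoods in the lexicographic order -/

namespace TwoLex

variable {α : Ordinal.{u}}

noncomputable instance : CompleteLinearOrder (TwoLex α) :=
  inferInstanceAs (CompleteLinearOrder (Lex (α.ToType → Fin 2)))

instance : CoeFun (TwoLex α) fun _ => α.ToType → Fin 2 := ⟨fun x => x⟩

/-- The point with the given digits. -/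
def ofDigits (f : α.ToType → Fin 2) : TwoLex α := f

@[simp] theorem ofDigits_apply (f : α.ToType → Fin 2) (i : α.ToType) : ofDigits f i = f i := rfl

theorem lt_def {x y : TwoLex α} : x < y ↔ ∃ i, (∀ j < i, x j = y j) ∧ x i < y i := Iff.rfl

/-- The points whose first difference from `y` is not at a place `j ≤ i` where `y` has
digit `b`. -/
def nearSet (y : TwoLex α) (b : Fin 2) (i : α.ToType) : Set (TwoLex α) :=
  {x | ∀ j ≤ i, y j = b → (∀ k < j, x k = y k) → x j = b}

theorem nearSet_antitone (y : TwoLex α) (b : Fin 2) : Antitone (nearSet y b) :=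
  fun _ _ h _ hx j hj => hx j (hj.trans h)

theorem self_mem_nearSet (y : TwoLex α) (b : Fin 2) (i : α.ToType) : y ∈ nearSet y b i :=
  fun _ _ h _ => h

theorem nearSet_one_eq_Ici {y : TwoLex α} {i : α.ToType} :
    nearSet y 1 i = Set.Ici (ofDigits fun j => if j ≤ i then y j else 0) := by
  ext x
  rw [Set.mem_Ici, ← not_lt, lt_def]
  simp only [nearSet, Set.mem_ofPred_eq, ofDigits_apply]
  constructor
  · rintro h ⟨j, hj, hlt⟩
    by_cases hji : j ≤ i
    · rw [if_pos hji] at hlt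
      have h1 : y j = 1 := by omega
      have := h j hji h1 fun k hk => by rw [hj k hk, if_pos (hk.le.trans hji)]
      omega
    · rw [if_neg hji] at hlt
      omega
  · intro h j hji h1 hk
    by_contra hx
    refine h ⟨j, fun k hkj => ?_, ?_⟩
    · rw [if_pos (hkj.le.trans hji), hk k hkj]
    · rw [if_pos hji]; omega

/-- The least element of `nearSet y 1 i` has an immediate predecessor: lower the digit at `i` to 0
and put 1 at all later places. -/
theorem nearSet_one_eq_Ioi {y : TwoLex α} {i : α.ToType} (hi : y i = 1) :
    nearSet y 1 i =
      Set.Ioi (ofDigits fun j => if j < i then y j else if j = i then 0 else 1) := by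
  ext x
  refine ⟨fun h => lt_of_lt_of_le (lt_def.2 ⟨i, fun j hj => ?_, ?_⟩)
    (nearSet_one_eq_Ici.subset h), fun h => ?_⟩
  · simp [hj, hj.le]
  · simp [hi]
  obtain ⟨j, hj, hlt⟩ := lt_def.1 h
  simp only [ofDigits_apply] at hj hlt
  intro k hki hk1 hk
  have hji : j ≤ i := by
    by_contra hji
    rw [if_neg (by order), if_neg (by order)] at hlt
    omega
  rcases lt_trichotomy k j with hkj | rfl | hjk
  · rw [← hj k hkj, if_pos (by order), hk1]
  · omega
  · rw [if_pos (by order), hk j hjk] at hlt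
    exact absurd hlt (lt_irrefl _)

/-- Exchange the digits `0` and `1`. -/
def flip (x : TwoLex α) : TwoLex α := ofDigits fun i => (x i).rev

@[simp] theorem flip_apply (x : TwoLex α) (i : α.ToType) : flip x i = (x i).rev := rfl

@[simp] theorem flip_flip (x : TwoLex α) : flip (flip x) = x :=
  funext fun i => Fin.rev_rev (x i)

theorem flip_lt_flip {x y : TwoLex α} : flip x < flip y ↔ y < x := by
  simp only [lt_def, flip_apply, Fin.rev_inj, Fin.rev_lt_rev]
  simp only [eq_comm]

/-- Exchanging the digits is an isomorphism onto the dual order. -/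
def flipOrderIso : TwoLex α ≃o (TwoLex α)ᵒᵈ where
  toFun x := OrderDual.toDual (flip x)
  invFun x := flip (OrderDual.ofDual x)
  left_inv := flip_flip
  right_inv := flip_flip
  map_rel_iff' {x y} := by
    change flip y ≤ flip x ↔ x ≤ y
    rw [← not_lt, flip_lt_flip, not_lt]

theorem continuous_flip : Continuous (flip : TwoLex α → TwoLex α) :=
  continuous_ofDual.comp flipOrderIso.continuous

theorem nearSet_zero_eq (y : TwoLex α) (i : α.ToType) :
    nearSet y 0 i = flip ⁻¹' nearSet (flip y) 1 i := by
  ext x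
  simp only [nearSet, Set.mem_ofPred_eq, Set.mem_preimage, flip_apply, Fin.rev_inj]
  have h : ∀ a : Fin 2, a.rev = 1 ↔ a = 0 := by decide
  simp only [h]

theorem isClopen_nearSet_one {y : TwoLex α} {i : α.ToType} (hi : y i = 1) :
    IsClopen (nearSet y 1 i) :=
  ⟨nearSet_one_eq_Ici ▸ isClosed_Ici, nearSet_one_eq_Ioi hi ▸ isOpen_Ioi⟩

theorem isClopen_nearSet {y : TwoLex α} {b : Fin 2} {i : α.ToType} (hi : y i = b) :
    IsClopen (nearSet y b i) := by
  obtain rfl | rfl : b = 0 ∨ b = 1 := by omega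
  · rw [nearSet_zero_eq]
    exact (isClopen_nearSet_one (by rw [flip_apply, hi]; rfl)).preimage continuous_flip
  · exact isClopen_nearSet_one hi

/-- Take `i` to be the first difference of `a` and `y`, so `y i = 1`. A point of `nearSet y 1 i`
below `y` agrees with `y` through `i`, hence exceeds `a`. -/
theorem exists_nearSet_subset_Ioi {a y : TwoLex α} (h : a < y) :
    ∃ i, nearSet y (y i) i ⊆ Set.Ioi a := by
  obtain ⟨i, hi, hlt⟩ := lt_def.1 h
  refine ⟨i, fun x hx => ?_⟩
  by_contra hax
  have hxy : x < y := lt_of_le_of_lt (not_lt.1 hax) h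
  obtain ⟨j, hj, hj'⟩ := lt_def.1 hxy
  have h1 : y i = 1 := by omega
  rcases le_or_gt j i with hji | hij
  · have := hx j hji (by omega) hj
    omega
  · exact hax (lt_def.2 ⟨i, fun k hk => by rw [hi k hk, hj k (hk.trans hij)],
      by rw [hj i hij]; exact hlt⟩)

theorem exists_nearSet_subset_Iio {a y : TwoLex α} (h : y < a) :
    ∃ i, nearSet y (y i) i ⊆ Set.Iio a := by
  obtain ⟨i, hi⟩ := exists_nearSet_subset_Ioi (flip_lt_flip.2 h)
  refine ⟨i, fun x hx => flip_lt_flip.1 (hi fun j hji hj hk => ?_)⟩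
  simp only [flip_apply, Fin.rev_inj] at hj hk ⊢
  exact hx j hji hj hk

/-- Change the digit at place `i`. -/
noncomputable def flipAt (y : TwoLex α) (i : α.ToType) : TwoLex α :=
  ofDigits fun j => if j = i then (y j).rev else y j

/-- The only difference from `y` is at `i`, so only sets for the digit `y i` with index at least `i`
exclude the new point. -/
theorem flipAt_mem_nearSet_iff {y : TwoLex α} {b : Fin 2} {i j : α.ToType} :
    flipAt y i ∈ nearSet y b j ↔ (y i = b → j < i) := by
  have hrev : ∀ a : Fin 2, a.rev ≠ a := by decide
  simp only [nearSet, flipAt, Set.mem_ofPred_eq, ofDigits_apply]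
  constructor
  · intro h hb
    by_contra hij
    have := h i (not_lt.1 hij) hb fun k hk => if_neg hk.ne
    rw [if_pos rfl, ← hb] at this
    exact hrev _ this
  · intro h k hkj hk _
    have hki : k ≠ i := by
      rintro rfl
      exact absurd (h hk) (not_lt.2 hkj)
    rw [if_neg hki, hk]

end TwoLex

/-! ### Cofinality in `ω_m` -/

open Cardinal Order in
theorem isRegular_aleph_natCast (m : ℕ) : (ℵ_ (m : Ordinal.{u})).IsRegular := by
  cases m with
  | zero => simpa using isRegular_aleph0
  | succ m => simpa using isRegular_aleph_add_one (m : Ordinal.{u})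

-- Lets `Order.enum` enumerate any cofinal set of places in type `ω_m`.
open Cardinal Order in
instance isRegularCardinalOrder_omega_natCast (m : ℕ) :
    IsRegularCardinalOrder (ω_ (m : Ordinal.{u})).ToType where
  type_lt_le_ord_cof := by
    rw [Ordinal.type_toType, Ordinal.cof_toType, (isRegular_aleph_natCast m).cof_omega_eq,
      ord_aleph]

open Cardinal Order in
/-- The members of an antitone family indexed by a subset of `ω_ m` are refined by an antitone
family indexed by some `ω_ k` with `k ≤ m`; here `D` collects the candidates for all `k`. -/
theorem exists_antitone_refinement {X : Type*} (m : ℕ) (T : Set (ω_ (m : Ordinal.{u})).ToType)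
    {N : (ω_ (m : Ordinal.{u})).ToType → Set X} (hN : Antitone N) :
    ∃ D : ∀ k : ℕ, (ω_ (k : Ordinal.{u})).ToType → Set X,
      (∀ k, Antitone (D k)) ∧ (∀ k α, D k α = Set.univ ∨ ∃ i ∈ T, D k α = N i) ∧
      ∀ i ∈ T, ∃ k ≤ m, ∃ α, D k α ⊆ N i := by
  by_cases hT : ∃ t ∈ T, ∀ i ∈ T, i ≤ t
  · obtain ⟨t, ht, htop⟩ := hT
    have : Nonempty (ω_ (m : Ordinal.{u})).ToType := ⟨t⟩
    exact ⟨fun _ _ => N t, fun _ => antitone_const, fun _ _ => Or.inr ⟨t, ht, rfl⟩,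
      fun i hi => ⟨m, le_rfl, t, hN (htop i hi)⟩⟩
  rcases T.eq_empty_or_nonempty with rfl | hne
  · exact ⟨fun _ _ => Set.univ, fun _ => antitone_const, fun _ _ => Or.inl rfl,
      fun i hi => absurd hi (Set.notMem_empty i)⟩
  have : Nonempty T := hne.to_subtype
  have : NoMaxOrder T := ⟨fun t => by
    by_contra! h
    exact hT ⟨t, t.2, fun i hi => h ⟨i, hi⟩⟩⟩
  -- Without a maximum, `T` has infinite cofinality, at most `ℵ_m`; so it is `ℵ_k₀` with `k₀`
  -- finite.
  obtain ⟨o, ho⟩ := mem_range_aleph_iff.2 (aleph0_le_cof (α := T))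
  have hle : ℵ_ o ≤ ℵ_ (m : Ordinal.{u}) := by
    rw [ho]
    refine (cof_le_cardinalMk T).trans ((mk_set_le T).trans ?_)
    rw [mk_toType, Ordinal.card_omega]
  rw [aleph_le_aleph] at hle
  obtain ⟨k₀, rfl⟩ := Ordinal.lt_omega0.1 (hle.trans_lt (Ordinal.natCast_lt_omega0 m))
  obtain ⟨s, hs, hstype⟩ := Ordinal.exists_ord_cof_eq T
  rw [← ho, ord_aleph, ← Ordinal.type_toType (ω_ (k₀ : Ordinal.{u}))] at hstype
  let e : (ω_ (k₀ : Ordinal.{u})).ToType ≃o s :=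
    .ofRelIsoLT (Ordinal.type_eq.1 hstype.symm).some
  refine ⟨fun k α => if h : k = k₀ then N (e (h ▸ α)) else Set.univ, fun k => ?_, fun k α => ?_,
    fun i hi => ?_⟩
  · by_cases h : k = k₀
    · subst h
      simp only [dite_true]
      exact fun α β hαβ => hN (e.monotone hαβ)
    · simp only [h, dite_false]
      exact antitone_const
  · by_cases h : k = k₀
    · subst h
      exact Or.inr ⟨e α, (e α).1.2, by simp⟩
    · exact Or.inl (by simp [h])
  · obtain ⟨j, hj, hij⟩ := hs ⟨i, hi⟩
    refine ⟨k₀, by exact_mod_cast hle, e.symm ⟨j, hj⟩, ?_⟩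
    simpa using hN hij

theorem exists_isCofinal_fiber {ι : Type*} [LinearOrder ι] (y : ι → Fin 2) :
    ∃ b, IsCofinal {i | y i = b} := by
  by_contra! h
  have h0 := h 0
  simp only [IsCofinal, not_forall, not_exists, not_and, not_le] at h0
  obtain ⟨x, hx⟩ := h0
  refine h 1 fun z => ⟨max z x, ?_, le_max_left z x⟩
  by_contra hz
  have h0 : y (max z x) = 0 := by
    have : y (max z x) ≠ 1 := hz
    omega
  exact absurd (hx _ h0) (not_lt.2 (le_max_right z x))

/-! ### Subbases in one factor and in the product -/

/-- A neighborhood subbase of a point of `2^{ω_m}_lex` made of a strictly decreasing sequence `C`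
of length `ω_m`, whose traces are realized by the points `w`, and of decreasing sequences `D k` of
lengths `ω_k` whose members contain all these points. -/
theorem TwoLex.exists_clopen_sequences (m : ℕ) (y : TwoLex (ω_ (m : Ordinal.{u}))) :
    ∃ (C : (ω_ (m : Ordinal.{u})).ToType → Set (TwoLex (ω_ (m : Ordinal.{u}))))
      (D : ∀ k : ℕ, (ω_ (k : Ordinal.{u})).ToType → Set (TwoLex (ω_ (m : Ordinal.{u}))))
      (w : (ω_ (m : Ordinal.{u})).ToType → TwoLex (ω_ (m : Ordinal.{u}))),
      Antitone C ∧ (∀ k, Antitone (D k)) ∧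
      (∀ α, IsClopen (C α)) ∧ (∀ k α, IsClopen (D k α)) ∧
      (∀ α, y ∈ C α) ∧ (∀ k α, y ∈ D k α) ∧
      (∀ α β, w α ∈ C β ↔ β < α) ∧ (∀ α k β, w α ∈ D k β) ∧
      ∀ i, (∃ α, C α ⊆ nearSet y (y i) i) ∨ ∃ k ≤ m, ∃ α, D k α ⊆ nearSet y (y i) i := by
  obtain ⟨b, hb⟩ := exists_isCofinal_fiber y
  let e := Order.enum _ hb
  have he : ∀ α, y (e α) = b := fun α => (e α).2
  obtain ⟨D, hanti, hD, hsub⟩ :=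
    exists_antitone_refinement m {i | y i ≠ b} (nearSet_antitone y b.rev)
  have hrev : ∀ b c : Fin 2, b ≠ c ↔ b = c.rev := by decide
  refine ⟨fun α => nearSet y b (e α), D, fun α => flipAt y (e α),
    fun _ _ h => nearSet_antitone y b (e.monotone h), hanti,
    fun α => isClopen_nearSet (he α), fun k α => ?_, fun α => self_mem_nearSet _ _ _,
    fun k α => ?_, fun α β => ?_, fun α k β => ?_, fun i => ?_⟩
  · rcases hD k α with h | ⟨i, hi, h⟩ <;> rw [h]
    exacts [isClopen_univ, isClopen_nearSet ((hrev _ _).1 hi)]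
  · rcases hD k α with h | ⟨i, hi, h⟩ <;> rw [h]
    exacts [Set.mem_univ _, self_mem_nearSet _ _ _]
  · rw [flipAt_mem_nearSet_iff]
    simp [he]
  · rcases hD k β with h | ⟨i, hi, h⟩ <;> rw [h]
    exacts [Set.mem_univ _,
      flipAt_mem_nearSet_iff.2 fun h => absurd (he α) ((hrev _ _).2 h)]
  · by_cases hi : y i = b
    · refine Or.inl ⟨e.symm ⟨i, hi⟩, ?_⟩
      simp [hi]
    · rw [(hrev _ _).1 hi]
      exact Or.inr (hsub i hi)

/-- Every point of the product has a clopen neighborhood subbase made of decreasing sequences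
all of whose combinations of traces are realized. -/
theorem TwoLexProd.exists_clopen_subbase (n : ℕ) (y : TwoLexProd n) :
    ∃ R : ∀ m : Fin (n + 1), (ω_ ((m : ℕ) : Ordinal.{0})).ToType → Set (TwoLexProd n),
      (∀ m, Antitone (R m)) ∧ (∀ m α, IsClopen (R m α)) ∧
      IsNeighborhoodSubbase y (⋃ m, Set.range (R m)) ∧
      ∀ t : ∀ m : Fin (n + 1), Set (ω_ ((m : ℕ) : Ordinal.{0})).ToType,
        (∀ m, IsLowerSet (t m)) → ∃ x, ∀ m α, x ∈ R m α ↔ α ∈ t m := by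
  choose C D w hCanti hDanti hC hD hyC hyD hwC hwD hsub using
    fun m : Fin (n + 1) => TwoLex.exists_clopen_sequences m (y m)
  let R : ∀ m : Fin (n + 1), (ω_ ((m : ℕ) : Ordinal.{0})).ToType → Set (TwoLexProd n) :=
    -- Coordinate `m` gives its main sequence, and every coordinate `j` its auxiliary sequence of
    -- length `ω_m`.
    fun m α => {x | x m ∈ C m α ∧ ∀ j, x j ∈ D j m α}
  have hclopen : ∀ m α, IsClopen (R m α) := fun m α => by
    have : R m α = (fun x => x m) ⁻¹' C m α ∩ ⋂ j, (fun x => x j) ⁻¹' D j m α := by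
      ext x; simp [R]
    rw [this]
    exact ((hC m α).preimage (continuous_apply m)).inter
      (isClopen_iInter_of_finite fun j => (hD j m α).preimage (continuous_apply j))
  refine ⟨R, fun m α β h x hx => ⟨hCanti m h hx.1, fun j => hDanti j m h (hx.2 j)⟩, hclopen,
    le_antisymm ?_ ?_, fun t ht => ?_⟩
  · have hR : ∀ m α, R m α ∈ Filter.generate (⋃ m, Set.range (R m)) := fun m α =>
      Filter.mem_generate_of_mem (Set.mem_iUnion.2 ⟨m, α, rfl⟩)
    have hnear : ∀ m i, {x : TwoLexProd n | x m ∈ TwoLex.nearSet (y m) (y m i) i} ∈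
        Filter.generate (⋃ m, Set.range (R m)) := fun m i => by
      rcases hsub m i with ⟨α, h⟩ | ⟨k, hk, α, h⟩
      · exact Filter.mem_of_superset (hR m α) fun x hx => h hx.1
      -- As `k ≤ m ≤ n`, the product has a sequence of length `ω_k`.
      · exact Filter.mem_of_superset (hR ⟨k, by omega⟩ α) fun x hx => h (hx.2 m)
    rw [nhds_pi, ← Filter.tendsto_id', Filter.tendsto_pi]
    refine fun m => tendsto_order.2 ⟨fun a ha => ?_, fun a ha => ?_⟩
    · obtain ⟨i, hi⟩ := TwoLex.exists_nearSet_subset_Ioi ha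
      exact Filter.mem_of_superset (hnear m i) fun x hx => hi hx
    · obtain ⟨i, hi⟩ := TwoLex.exists_nearSet_subset_Iio ha
      exact Filter.mem_of_superset (hnear m i) fun x hx => hi hx
  · rw [Filter.le_generate_iff]
    rintro _ ⟨_, ⟨m, rfl⟩, α, rfl⟩
    exact (hclopen m α).isOpen.mem_nhds ⟨hyC m α, fun j => hyD j m α⟩
  · have : ∀ m, ∃ p, (∀ α, p ∈ C m α ↔ α ∈ t m) ∧ ∀ k α, p ∈ D m k α := fun m => by
      rcases (ht m).eq_univ_or_Iio with h | ⟨δ, h⟩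
      · exact ⟨y m, fun α => by simp [h, hyC], hyD m⟩
      · exact ⟨w m δ, fun α => by simp [h, hwC], hwD m δ⟩
    choose p hpC hpD using this
    exact ⟨p, fun m α => ⟨fun h => (hpC m α).1 h.1, fun h => ⟨(hpC m α).2 h, fun j => hpD j m α⟩⟩⟩

/-! ### The theorem -/

/-- A point in all members of a neighborhood subbase at `a` equals `a`. -/
theorem IsNeighborhoodSubbase.forall_mem_iff {X : Type*} [TopologicalSpace X] [T1Space X] {a x : X}
    {S : Set (Set X)} (h : IsNeighborhoodSubbase a S) : (∀ s ∈ S, x ∈ s) ↔ x = a := by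
  constructor
  · intro hx
    have : pure x ≤ 𝓝 a := by
      rw [← h, Filter.le_generate_iff]
      exact hx
    exact pure_le_nhds_iff.1 this
  · rintro rfl s hs
    exact mem_of_mem_nhds (h ▸ Filter.mem_generate_of_mem hs)

theorem mainTheorem10 (n : ℕ) :
    PinHomogeneous (TwoLexProd n) ∧
      ∀ y : TwoLexProd n,
        ∃ R : ∀ m : Fin (n + 1), (ω_ ((m : ℕ) : Ordinal.{0})).ToType → Set (TwoLexProd n),
          (∀ m, StrictAnti (R m)) ∧
          IsNeighborhoodSubbase y (⋃ m, Set.range (R m)) ∧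
          IndependentSubalgebras
            (fun m => BooleanSubalgebra.closure (Set.range (R m))) := by
  refine ⟨⟨inferInstance, inferInstance, fun a b => ?_⟩, fun y => ?_⟩
  · obtain ⟨P, hPanti, hP, hPa, hPt⟩ := TwoLexProd.exists_clopen_subbase n a
    obtain ⟨Q, hQanti, hQ, hQb, hQt⟩ := TwoLexProd.exists_clopen_subbase n b
    refine pinEquivalent_of_clopen_families
      (J := Σ m : Fin (n + 1), (ω_ ((m : ℕ) : Ordinal.{0})).ToType)
      (P := fun j => P j.1 j.2) (Q := fun j => Q j.1 j.2) (fun j => hP _ _) (fun j => hQ _ _)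
      (fun x => ?_) (fun x => ?_) (fun x => ?_) (fun x => ?_)
    -- Traces on decreasing sequences are initial segments, all of which the other family realizes.
    · obtain ⟨x', hx'⟩ := hQt (fun m => {α | x ∈ P m α}) fun m α β h hx => hPanti m h hx
      exact ⟨x', fun j => (hx' _ _).symm⟩
    · obtain ⟨x', hx'⟩ := hPt (fun m => {α | x ∈ Q m α}) fun m α β h hx => hQanti m h hx
      exact ⟨x', fun j => (hx' _ _).symm⟩
    · rw [← hPa.forall_mem_iff]
      simp only [Sigma.forall, Set.mem_iUnion, Set.mem_range]
      grind
    · rw [← hQb.forall_mem_iff]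
      simp only [Sigma.forall, Set.mem_iUnion, Set.mem_range]
      grind
  · obtain ⟨R, hanti, -, hsub, ht⟩ := TwoLexProd.exists_clopen_subbase n y
    refine ⟨R, fun m α β h => (hanti m h.le).lt_of_ne fun heq => ?_, hsub,
      independentSubalgebras_of_traces fun z => ?_⟩
    -- A point with trace `Iio β` in sequence `m` separates `R m α` from `R m β`.
    · obtain ⟨x, hx⟩ := ht (Function.update (fun _ => ∅) m (Set.Iio β)) fun m' => by
        rcases eq_or_ne m' m with rfl | hm
        · rw [Function.update_self]
          exact isLowerSet_Iio β
        · rw [Function.update_of_ne hm]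
          exact isLowerSet_empty
      have hx := hx m
      simp only [Function.update_self, Set.mem_Iio] at hx
      exact lt_irrefl β ((hx β).1 (heq ▸ (hx α).2 h))
    · exact ht (fun m => {α | z m ∈ R m α}) fun m α β h hx => hanti m h hx
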